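/- Let $(X,Y)$ be a random pair in $\mathbb R^d\times\mathbb R$ with distribution $Q$ and let $(X_j,Y_j)_{j\ge 1}$ be i.i.d. with distribution $Q$, all defined on a probability space $(\Omega,\mathcal A,P)$. Assume that $Y$ is bounded: $|Y|\le L$ almost surely for some $L$. For $n\ge 1$ let $Q_n=\frac1n\sum_{j=1}^n\delta_{(X_j,Y_j)}$. For a Borel set $A\subseteq\mathbb R^d\times\mathbb R$ put, when $Q(A)>0$, $$E[h(Y)\mid A]=\frac{E[h(Y)\mathbf 1_{(X,Y)\in A}]}{P((X,Y)\in A)},\qquad V[Y\mid A]=E[Y^2\mid A]-E[Y\mid A]^2,$$ and, when $Q_n(A)>0$, $$E_n[h(Y)\mid A]=\frac{\sum_{j=1}^n h(Y_j)\mathbf 1_{(X_j,Y_j)\in A}}{\sum_{j=1}^n \mathbf 1_{(X_j,Y_j)\in A}},\qquad V_n[Y\mid A]=E_n[Y^2\mid A]-E_n[Y\mid A]^2 .$$ Let $P^*(E)=\inf\{P(B): E\subseteq B\in\mathcal A\}$ be the outer probability. For real maps $M_n$ on $\Omega$, not necessarily measurable, and $a_n>0$, write $M_n=O_{P^*}(a_n)$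 if $(M_n/a_n)$ is asymptotically tight: for every $\varepsilon>0$ there is a compact $K\subset\mathbb R$ such that $\limsup_n P^*(d(M_n/a_n,K)\ge\delta)<\varepsilon$ for every $\delta>0$. Let $\mathfrak B$ be a $Q$-Donsker class of Borel subsets of $\mathbb R^d\times\mathbb R$; that is, the empirical processes $\big(\sqrt n\,(Q_n(A)-Q(A))\big)_{A\in\mathfrak B}$ of the coordinate sample on the product space $\big((\mathbb R^d\times\mathbb R)^{\mathbb N},Q^{\otimes\mathbb N}\big)$ converge in distribution (in the sense of outer expectations of bounded continuous functions) in $\ell^\infty(\mathfrak B)$ to a tight Borel limit. Let $\alpha\in[0,1/2)$ and $\mathfrak B_n=\{A\in\mathfrak B: Q_n(A)\ge n^{-\alpha}\}$. Then $P^*(\exists A\in\mathfrak B_n: Q(A)=0)\to 0$, so that with outer probability tending to one the conditional quantities are all well defined on $\mathfrak B_n$; for every $i\in\mathbb N$, $$\sup_{A\in\mathfrak B_n}\big|E_n[Y^i\mid A]-E[Y^i\mid A]\big|=O_{P^*}(n^{\alpha-1/2});$$ and $$\sup_{A\in\mathfrak B_n}\big|V_n[Y\mid A]-V[Y\mid A]\big|=O_{P^*}(n^{\alpha-1/2}).$$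 (The supremum over an empty family is $0$, and $E[h(Y)\mid A]:=0$ if $Q(A)=0$.) -/

import Mathlib

open MeasureTheory ProbabilityTheory Filter Topology
open scoped ENNReal BoundedContinuousFunction

noncomputable section

/-! ### Outer probability and outer expectation -/

/-- Outer probability of an arbitrary subset of a probability space:
the infimum of the probabilities of the measurable sets containing it. -/
def outerProb {Ω : Type*} [MeasurableSpace Ω] (P : Measure Ω) (E : Set Ω) : ℝ≥0∞ :=
  ⨅ (B : Set Ω) (_ : E ⊆ B) (_ : MeasurableSet B), P B

/-- Mathlib's measures are already extended to all sets by their outer measure. -/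
theorem outerProb_eq {Ω : Type*} [MeasurableSpace Ω] (P : Measure Ω) (E : Set Ω) :
    outerProb P E = P E := by
  rw [measure_eq_iInf]; rfl

/-- Outer expectation of a bounded, possibly non-measurable, function:
the infimum of the expectations of its measurable integrable majorants. -/
def outerExp {Ω : Type*} [MeasurableSpace Ω] (P : Measure Ω) (T : Ω → ℝ) : ℝ :=
  sInf {r : ℝ | ∃ U : Ω → ℝ, Measurable U ∧ Integrable U P ∧ (∀ ω, T ω ≤ U ω) ∧ ∫ ω, U ω ∂P = r}

/-- Asymptotic tightness of a sequence of (possibly non-measurable) maps with values in a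
metric space; `Metric.thickening δ K` is `{y | d(y, K) < δ}`. -/
def AsymptoticallyTight {Ω D : Type*} [MeasurableSpace Ω] [PseudoMetricSpace D]
    (P : Measure Ω) (M : ℕ → Ω → D) : Prop :=
  ∀ ε : ℝ≥0∞, 0 < ε → ∃ K : Set D, IsCompact K ∧ ∀ δ : ℝ, 0 < δ →
    limsup (fun n => outerProb P {ω | M n ω ∉ Metric.thickening δ K}) atTop < ε

/-- `M n = O_{P*}(a n)`: the real-valued maps `M n / a n` are asymptotically tight. -/
def IsBigOOuter {Ω : Type*} [MeasurableSpace Ω] (P : Measure Ω) (M : ℕ → Ω → ℝ) (a : ℕ → ℝ) :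
    Prop :=
  AsymptoticallyTight P (fun n ω => M n ω / a n)

/-- Convergence in distribution of (possibly non-measurable) maps `M n : Ω → D` to a Borel law `μ`
on the metric space `D`: `E^* h(M n) → ∫ h dμ` for every bounded continuous real function `h`. -/
def OuterTendstoInLaw {Ω D : Type*} [MeasurableSpace Ω] [TopologicalSpace D] [MeasurableSpace D]
    (P : Measure Ω) (M : ℕ → Ω → D) (μ : Measure D) : Prop :=
  ∀ h : D →ᵇ ℝ, Tendsto (fun n => outerExp P (fun ω => h (M n ω))) atTop (𝓝 (∫ y, h y ∂μ))

/-! ### Empirical processes and Donsker classes -/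

/-- `∫ f dQ_n`, where `Q_n` is the empirical measure of the first `n` points of the sample `z`. -/
def empMean {S : Type*} (z : ℕ → S) (n : ℕ) (f : S → ℝ) : ℝ :=
  (∑ j ∈ Finset.range n, f (z j)) / n

/-- The empirical process `v_n f = √n (∫ f dQ_n - ∫ f dQ)`. -/
def empProcess {S : Type*} [MeasurableSpace S] (Q : Measure S) (z : ℕ → S) (n : ℕ)
    (f : S → ℝ) : ℝ :=
  √(n : ℝ) * (empMean z n f - ∫ x, f x ∂Q)

/-- The Banach space `ℓ^∞(T)` of bounded real functions on `T`, with the supremum norm. -/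
abbrev EllInfty (T : Type*) : Type _ := lp (fun _ : T => ℝ) ∞

/-- A class `F` of integrable functions is `Q`-Donsker if its empirical process is a sequence of
maps into `ℓ^∞(F)` which converges in distribution to a tight Borel law on `ℓ^∞(F)`. This being a
property of `Q` and `F` only, the sample is, as usual, the sequence of coordinate projections of
the product probability space `(S^ℕ, Q^ℕ)`, on which the outer expectations are taken. -/
def IsDonsker {S : Type*} [MeasurableSpace S] (Q : Measure S) [IsProbabilityMeasure Q]
    (F : Set (S → ℝ)) : Prop :=
  (∀ f ∈ F, Integrable f Q) ∧
  ∃ G : ℕ → (ℕ → S) → EllInfty F,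
    (∀ n z, ∀ f : F, G n z f = empProcess Q z n f) ∧
    letI : MeasurableSpace (EllInfty F) := borel (EllInfty F)
    ∃ μ : Measure (EllInfty F), IsProbabilityMeasure μ ∧ IsTightMeasureSet {μ} ∧
      OuterTendstoInLaw (Measure.infinitePi (fun _ : ℕ => Q)) G μ

/-- A class of sets is `Q`-Donsker if the class of its indicator functions is. -/
def IsDonskerSets {S : Type*} [MeasurableSpace S] (Q : Measure S) [IsProbabilityMeasure Q]
    (𝔅 : Set (Set S)) : Prop :=
  IsDonsker Q {f | ∃ A ∈ 𝔅, f = A.indicator (fun _ => 1)}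

/-! ### Conditional expectations and variances given an event, and empirical counterparts -/

/-- `Q_n(A)`, the proportion of the first `n` points of the sample `z` that lie in `A`. -/
def empMeasure {S : Type*} (z : ℕ → S) (n : ℕ) (A : Set S) : ℝ :=
  empMean z n (A.indicator (fun _ => 1))

/-- `E[h(Y) | W ∈ A] = E[h(Y) 1_{W ∈ A}] / P(W ∈ A)`; meaningful if `P(W ∈ A) > 0`. -/
def condE {Ω S : Type*} [MeasurableSpace Ω] (P : Measure Ω) (W : Ω → S) (Y : Ω → ℝ)
    (h : ℝ → ℝ) (A : Set S) : ℝ :=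
  (∫ ω, (W ⁻¹' A).indicator (fun ω => h (Y ω)) ω ∂P) / P.real (W ⁻¹' A)

/-- `V[Y | W ∈ A] = E[Y² | W ∈ A] - E[Y | W ∈ A]²`. -/
def condV {Ω S : Type*} [MeasurableSpace Ω] (P : Measure Ω) (W : Ω → S) (Y : Ω → ℝ)
    (A : Set S) : ℝ :=
  condE P W Y (fun y => y ^ 2) A - condE P W Y (fun y => y) A ^ 2

/-- `E_n[h(Y) | (X, Y) ∈ A]`: the average of `h(y)` over those of the first `n` points `(x, y)` of
the sample `z` that lie in `A`; meaningful if there is such a point. -/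
def empCondE {E : Type*} (z : ℕ → E × ℝ) (n : ℕ) (h : ℝ → ℝ) (A : Set (E × ℝ)) : ℝ :=
  (∑ j ∈ Finset.range n, A.indicator (fun w => h w.2) (z j)) /
    (∑ j ∈ Finset.range n, A.indicator (fun _ => 1) (z j))

/-- `V_n[Y | (X, Y) ∈ A] = E_n[Y² | (X, Y) ∈ A] - E_n[Y | (X, Y) ∈ A]²`. -/
def empCondV {E : Type*} (z : ℕ → E × ℝ) (n : ℕ) (A : Set (E × ℝ)) : ℝ :=
  empCondE z n (fun y => y ^ 2) A - empCondE z n (fun y => y) A ^ 2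

/-- The random class `𝔅_n = {A ∈ 𝔅 : Q_n(A) ≥ n^{-α}}`. -/
def frequentSets {S : Type*} (𝔅 : Set (Set S)) (α : ℝ) (z : ℕ → S) (n : ℕ) : Set (Set S) :=
  {A | A ∈ 𝔅 ∧ (n : ℝ) ^ (-α) ≤ empMeasure z n A}

end

/-! An empirical conditional mean is the sum of `h 1_A` over the sample divided by the count of `A`.
If both deviate from `n` times their integrals by O(√n) uniformly in `A ∈ 𝔅`, then, the count being
at least `n^(1-α)` on frequent sets, the error is O(√n / n^(1-α)), which is the rate
(`abs_div_sub_le`). Variances follow by factoring a difference of squares.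

The Donsker property gives the uniform bound for the counts, since a convergent sequence with tight
limit is bounded in outer probability (`IsDonskerSets.isOuterBounded`). The crux is to pass from
`1_A` to `h 1_A` (`IsOuterBounded.of_mem_Icc`). By an affine change, `h` becomes some `g` with
values in `[0, 1]`. Keep each sample point `x` with probability `g x`, and otherwise replace it by a
fresh draw from the law `R` with density proportional to `1 - g`. The new sample is again i.i.d.
with law `Q`, so its counts are controlled. Given the old sample, the expected new count of `A` is
`∑ g 1_A + (n - ∑ g) R(A)`. If some `A` has a large deviation of `∑ g 1_A`, Chebyshev for that
single `A` shows that the new count deviates too, with conditional probability at least 1/2. Fubini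
and Markov then bound the probability of such old samples. -/

/-- Chebyshev's inequality for sums of independent random variables with values in `[0, 1]`. -/
theorem measure_deviation_sum_le {Ω : Type*} [MeasurableSpace Ω] (P : Measure Ω)
    [IsProbabilityMeasure P] {X : ℕ → Ω → ℝ} (hX : ∀ j, Measurable (X j)) (hind : iIndepFun X P)
    (hb : ∀ j ω, X j ω ∈ Set.Icc (0 : ℝ) 1) {n : ℕ} (hn : n ≠ 0) {c : ℝ} (hc : 0 < c) :
    P {ω | c * √n ≤ |∑ j ∈ Finset.range n, X j ω - ∑ j ∈ Finset.range n, ∫ ω, X j ω ∂P|}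
      ≤ ENNReal.ofReal (1 / c ^ 2) := by
  have hL (j) : MemLp (X j) 2 P :=
    memLp_of_bounded (.of_forall (hb j)) (hX j).aestronglyMeasurable 2
  have hn' : (0 : ℝ) < n := by positivity
  have hS : MemLp (∑ j ∈ Finset.range n, X j) 2 P := memLp_finsetSum' _ fun j _ => hL j
  have key := meas_ge_le_variance_div_sq hS (c := c * √n) (by positivity)
  have hmean : P[∑ j ∈ Finset.range n, X j] = ∑ j ∈ Finset.range n, ∫ ω, X j ω ∂P := by
    simp only [Finset.sum_apply]
    exact integral_finsetSum _ fun j _ => (hL j).integrable (by norm_num)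
  have hvar : variance (∑ j ∈ Finset.range n, X j) P ≤ n := by
    rw [IndepFun.variance_sum (fun j _ => hL j) fun i _ j _ hij => hind.indepFun hij]
    calc _ ≤ ∑ j ∈ Finset.range n, (1 : ℝ) := by
          refine Finset.sum_le_sum fun j _ => ?_
          have := variance_le_sq_of_bounded (.of_forall (hb j)) (hX j).aemeasurable (μ := P)
          norm_num at this
          linarith
      _ = n := by simp
  rw [hmean] at key
  simp only [Finset.sum_apply] at key
  refine key.trans (ENNReal.ofReal_le_ofReal ?_)
  rw [mul_pow, Real.sq_sqrt hn'.le, div_le_div_iff₀ (by positivity) (by positivity)]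
  nlinarith [sq_nonneg c]

/-! ### Resampling a point without changing its law -/

section Resampling

variable {S T : Type*} [MeasurableSpace S] [MeasurableSpace T]

/-- A coordinatewise transformation which maps `Q ⊗ τ` to `Q` maps the product of the
corresponding sequence laws to the law of an i.i.d. sequence. -/
theorem measurePreserving_seq {Q : Measure S} [IsProbabilityMeasure Q] {τ : Measure T}
    [IsProbabilityMeasure τ] {Φ : S × T → S} (hΦ : MeasurePreserving Φ (Q.prod τ) Q) :
    MeasurePreserving (fun (p : (ℕ → S) × (ℕ → T)) (j : ℕ) => Φ (p.1 j, p.2 j))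
      ((Measure.infinitePi fun _ => Q).prod (Measure.infinitePi fun _ => τ))
      (Measure.infinitePi fun _ => Q) := by
  have hm := hΦ.measurable
  have hmeas : Measurable (fun (p : (ℕ → S) × (ℕ → T)) (j : ℕ) => Φ (p.1 j, p.2 j)) := by
    fun_prop
  refine ⟨hmeas, Measure.eq_infinitePi _ fun s t ht => ?_⟩
  have hbox : MeasurableSet (Set.pi (s : Set ℕ) t) :=
    MeasurableSet.pi s.countable_toSet fun i _ => ht i
  rw [Measure.map_apply hmeas hbox, Measure.prod_apply (hmeas hbox)]
  have hsec (z : ℕ → S) : (Measure.infinitePi fun _ : ℕ => τ)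
      (Prod.mk z ⁻¹' ((fun (p : (ℕ → S) × (ℕ → T)) (j : ℕ) => Φ (p.1 j, p.2 j)) ⁻¹'
        Set.pi (s : Set ℕ) t)) = ∏ i ∈ s, τ (Prod.mk (z i) ⁻¹' (Φ ⁻¹' t i)) :=
    Measure.infinitePi_pi (μ := fun _ : ℕ => τ) fun i _ => measurable_prodMk_left (hm (ht i))
  have hmsec (i : ℕ) : Measurable fun x => τ (Prod.mk x ⁻¹' (Φ ⁻¹' t i)) :=
    measurable_measure_prodMk_left (hm (ht i))
  simp_rw [hsec]
  -- Given `z`, the box has product probability; independence of the coordinates of `z` then factors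
  -- the outer integral, and Fubini identifies each factor with `Q (t i)`.
  rw [lintegral_prod_eq_prod_lintegral_of_indepFun s
    (fun i (z : ℕ → S) => τ (Prod.mk (z i) ⁻¹' (Φ ⁻¹' t i)))
    (iIndepFun_infinitePi (P := fun _ => Q) hmsec)
    fun i => (hmsec i).comp (measurable_pi_apply i)]
  refine Finset.prod_congr rfl fun i _ => ?_
  rw [← hΦ.measure_preimage (ht i).nullMeasurableSet, Measure.prod_apply (hm (ht i)),
    ← (measurePreserving_eval_infinitePi (fun _ : ℕ => Q) i).lintegral_comp (hmsec i)]

/-- Keep `x` if the label `u` is at most `g x`, and replace it by `y` otherwise. -/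
noncomputable def resample (g : S → ℝ) (p : S × (unitInterval × S)) : S :=
  open Classical in if (p.2.1 : ℝ) ≤ g p.1 then p.1 else p.2.2

theorem measurable_resample {g : S → ℝ} (hg : Measurable g) : Measurable (resample g) :=
  Measurable.ite (measurableSet_le (by fun_prop) (by fun_prop)) (by fun_prop) (by fun_prop)

/-- The label is uniform: `x` survives with probability `g x`, and otherwise an independent draw
from `R` lands in `A` with probability `R(A)`. -/
theorem measureReal_resample_section (R : Measure S) [IsProbabilityMeasure R] {g : S → ℝ}
    (hg : ∀ x, g x ∈ Set.Icc (0 : ℝ) 1) {A : Set S} (hA : MeasurableSet A) (x : S) :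
    ((volume : Measure unitInterval).prod R).real {t | resample g (x, t) ∈ A}
      = A.indicator g x + (1 - g x) * R.real A := by
  set c : unitInterval := ⟨g x, hg x⟩
  have hset : {t | resample g (x, t) ∈ A} = Set.Iic c ×ˢ {_y | x ∈ A} ∪ Set.Ioi c ×ˢ A := by
    ext t
    by_cases h : (t.1 : ℝ) ≤ g x
    · simp [resample, h, c, ← Subtype.coe_le_coe, ← Subtype.coe_lt_coe]
    · simp [resample, h, c, ← Subtype.coe_le_coe, ← Subtype.coe_lt_coe, not_le.1 h]
  have hdisj : Disjoint (Set.Iic c ×ˢ {_y : S | x ∈ A}) (Set.Ioi c ×ˢ A) :=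
    Set.Disjoint.set_prod_left (Set.Iic_disjoint_Ioi le_rfl) _ _
  rw [hset, measureReal_union hdisj (measurableSet_Ioi.prod hA), measureReal_prod_prod,
    measureReal_prod_prod]
  have h1 : (volume : Measure unitInterval).real (Set.Iic c) = g x := by
    simp [Measure.real, c, (hg x).1]
  have h2 : (volume : Measure unitInterval).real (Set.Ioi c) = 1 - g x := by
    simp [Measure.real, c, (hg x).2]
  rw [h1, h2]
  by_cases hx : x ∈ A <;> simp [hx]

theorem integral_indicator_resample (R : Measure S) [IsProbabilityMeasure R] {g : S → ℝ}
    (hgm : Measurable g) (hg : ∀ x, g x ∈ Set.Icc (0 : ℝ) 1) {A : Set S} (hA : MeasurableSet A)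
    (x : S) :
    ∫ t, A.indicator (fun _ => (1 : ℝ)) (resample g (x, t))
        ∂((volume : Measure unitInterval).prod R)
      = A.indicator g x + (1 - g x) * R.real A := by
  rw [← measureReal_resample_section R hg hA x, ← integral_indicator_one]
  · rfl
  · exact ((measurable_resample hgm).comp measurable_prodMk_left) hA

/-- Integrating the section probabilities over `x` gives `∫_A g dQ + (1 - ∫ g dQ) R(A)`, and `hR`
says that this is `Q(A)`. -/
theorem measurePreserving_resample {Q R : Measure S} [IsProbabilityMeasure Q]
    [IsProbabilityMeasure R] {g : S → ℝ} (hgm : Measurable g)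
    (hg : ∀ x, g x ∈ Set.Icc (0 : ℝ) 1)
    (hR : ∀ A, MeasurableSet A → (1 - ∫ x, g x ∂Q) * R.real A
      = Q.real A - ∫ x, A.indicator g x ∂Q) :
    MeasurePreserving (resample g) (Q.prod ((volume : Measure unitInterval).prod R)) Q := by
  have hm := measurable_resample hgm
  refine ⟨hm, Measure.ext fun A hA => ?_⟩
  have hgi : Integrable g Q :=
    (memLp_of_bounded (.of_forall hg) hgm.aestronglyMeasurable 1).integrable le_rfl
  have h0 (x : S) : 0 ≤ A.indicator g x + (1 - g x) * R.real A :=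
    add_nonneg (Set.indicator_nonneg (fun x _ => (hg x).1) x)
      (mul_nonneg (sub_nonneg.2 (hg x).2) measureReal_nonneg)
  have hi1 : Integrable (fun x => (1 - g x) * R.real A) Q :=
    ((integrable_const 1).sub hgi).mul_const _
  have hi2 : Integrable (fun x => A.indicator g x + (1 - g x) * R.real A) Q :=
    (hgi.indicator hA).add hi1
  rw [Measure.map_apply hm hA, Measure.prod_apply (hm hA)]
  have hsec (x : S) : ((volume : Measure unitInterval).prod R)
      (Prod.mk x ⁻¹' (resample g ⁻¹' A))
        = ENNReal.ofReal (A.indicator g x + (1 - g x) * R.real A) := by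
    rw [← measureReal_resample_section R hg hA x, ofReal_measureReal]
    rfl
  simp_rw [hsec]
  rw [← ofReal_integral_eq_lintegral_ofReal hi2 (.of_forall h0),
    integral_add (hgi.indicator hA) hi1, integral_mul_const,
    integral_sub (integrable_const 1) hgi, integral_const, probReal_univ, one_smul, hR A hA,
    add_sub_cancel, ofReal_measureReal]

/-- The law with density proportional to `1 - g`. -/
theorem exists_law_one_sub (Q : Measure S) [IsProbabilityMeasure Q] {g : S → ℝ}
    (hgm : Measurable g) (hg : ∀ x, g x ∈ Set.Icc (0 : ℝ) 1) (hg1 : ∫ x, g x ∂Q < 1) :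
    ∃ R : Measure S, IsProbabilityMeasure R ∧ ∀ A, MeasurableSet A →
      (1 - ∫ x, g x ∂Q) * R.real A = Q.real A - ∫ x, A.indicator g x ∂Q := by
  have hgi : Integrable g Q :=
    (memLp_of_bounded (.of_forall hg) hgm.aestronglyMeasurable 1).integrable le_rfl
  have hi1 : Integrable (fun x => 1 - g x) Q := (integrable_const 1).sub hgi
  have hpos : 0 < 1 - ∫ x, g x ∂Q := sub_pos.2 hg1
  have hreal {A : Set S} (hA : MeasurableSet A) :
      (Q.withDensity fun x => ENNReal.ofReal (1 - g x)) A
        = ENNReal.ofReal (Q.real A - ∫ x, A.indicator g x ∂Q) := by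
    rw [withDensity_apply _ hA, ← ofReal_integral_eq_lintegral_ofReal
      hi1.restrict (.of_forall fun x => sub_nonneg.2 (hg x).2),
      integral_sub (integrable_const 1) hgi.restrict, integral_indicator hA]
    simp
  have hnn {A : Set S} (hA : MeasurableSet A) : 0 ≤ Q.real A - ∫ x, A.indicator g x ∂Q := by
    rw [sub_nonneg, ← integral_indicator_one hA]
    refine integral_mono (hgi.indicator hA) ((integrable_const 1).indicator hA) fun x => ?_
    exact Set.indicator_le_indicator (hg x).2
  refine ⟨ENNReal.ofReal (1 - ∫ x, g x ∂Q)⁻¹ •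
    Q.withDensity fun x => ENNReal.ofReal (1 - g x), ⟨?_⟩, fun A hA => ?_⟩
  · rw [Measure.smul_apply, hreal .univ, smul_eq_mul, ← ENNReal.ofReal_mul (by positivity)]
    simp [inv_mul_cancel₀ hpos.ne']
  · rw [measureReal_ennreal_smul_apply, Measure.real, hreal hA, ENNReal.toReal_ofReal (hnn hA),
      ENNReal.toReal_ofReal (by positivity), mul_inv_cancel_left₀ hpos.ne']

end Resampling

/-! ### From indicators to weighted indicators -/

section Bounded

variable {S : Type*} [MeasurableSpace S]

/-- The centred sum `n (∫ f dQ_n - ∫ f dQ)`. -/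
noncomputable def centredSum (Q : Measure S) (z : ℕ → S) (n : ℕ) (f : S → ℝ) : ℝ :=
  ∑ j ∈ Finset.range n, f (z j) - n * ∫ x, f x ∂Q

/-- The empirical process indexed by the functions `h 1_A`, `A ∈ 𝔅`, is bounded in outer
probability, uniformly in the sample size. -/
def IsOuterBounded (Q : Measure S) [IsProbabilityMeasure Q] (𝔅 : Set (Set S)) (h : S → ℝ) :
    Prop :=
  ∀ ε : ℝ≥0∞, 0 < ε → ∃ T : ℝ, 0 ≤ T ∧ ∀ n : ℕ, Measure.infinitePi (fun _ : ℕ => Q)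
    {z | ∃ A ∈ 𝔅, T * √n < |centredSum Q z n (A.indicator h)|} ≤ ε

theorem integral_eval_infinitePi (Q : Measure S) [IsProbabilityMeasure Q] {f : S → ℝ}
    (hf : Measurable f) (j : ℕ) :
    ∫ z : ℕ → S, f (z j) ∂(Measure.infinitePi fun _ => Q) = ∫ x, f x ∂Q := by
  have h := measurePreserving_eval_infinitePi (fun _ : ℕ => Q) j
  rw [← integral_map h.measurable.aemeasurable hf.aestronglyMeasurable, h.map_eq]

theorem exists_ofReal_one_div_sq_le {ε : ℝ≥0∞} (hε : 0 < ε) :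
    ∃ c : ℝ, 0 < c ∧ ENNReal.ofReal (1 / c ^ 2) ≤ ε := by
  have h1 : Tendsto (fun c : ℝ => ENNReal.ofReal (1 / c ^ 2)) atTop (𝓝 (ENNReal.ofReal 0)) := by
    refine ENNReal.tendsto_ofReal ?_
    simpa [Pi.inv_def] using (tendsto_pow_atTop (α := ℝ) two_ne_zero).inv_tendsto_atTop
  rw [ENNReal.ofReal_zero] at h1
  obtain ⟨c, hc0, hc⟩ := ((eventually_gt_atTop 0).and (h1.eventually (gt_mem_nhds hε))).exists
  exact ⟨c, hc0, hc.le⟩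

/-- Multiplication by a fixed function with values in `[0, 1]` preserves boundedness in outer
probability of the empirical process of a class of sets. -/
theorem IsOuterBounded.of_mem_Icc {Q : Measure S} [IsProbabilityMeasure Q] {𝔅 : Set (Set S)}
    (h𝔅 : ∀ A ∈ 𝔅, MeasurableSet A) (hB : IsOuterBounded Q 𝔅 fun _ => 1) {g : S → ℝ}
    (hgm : Measurable g) (hg : ∀ x, g x ∈ Set.Icc (0 : ℝ) 1) (hg1 : ∫ x, g x ∂Q < 1) :
    IsOuterBounded Q 𝔅 g := by
  intro ε hε
  obtain ⟨R, hRp, hR⟩ := exists_law_one_sub Q hgm hg hg1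
  -- Markov's inequality at level 1/2 will double this `ε / 4`.
  obtain ⟨T, hT0, hT⟩ := hB (ε / 4) (ENNReal.div_pos hε.ne' (by norm_num))
  obtain ⟨c, hc0, hc⟩ := exists_ofReal_one_div_sq_le (ENNReal.half_pos hε.ne')
  -- `T` bounds the resampled counts, `2` comes from Chebyshev given `z`, and `c` from the
  -- fluctuation of `∑ g (z j)`.
  refine ⟨T + 2 + c, by positivity, fun n => ?_⟩
  rcases eq_or_ne n 0 with rfl | hn
  · simp [centredSum]
  set μ : Measure (ℕ → S) := Measure.infinitePi fun _ => Q
  set τ : Measure (unitInterval × S) := (volume : Measure unitInterval).prod R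
  set ν : Measure (ℕ → unitInterval × S) := Measure.infinitePi fun _ => τ
  set E : Set (ℕ → S) := {z | ∃ A ∈ 𝔅, T * √n < |centredSum Q z n (A.indicator fun _ => 1)|}
  set w : (ℕ → S) × (ℕ → unitInterval × S) → ℕ → S := fun p j => resample g (p.1 j, p.2 j)
  have hw : MeasurePreserving w (μ.prod ν) μ :=
    measurePreserving_seq (measurePreserving_resample hgm hg hR)
  have hrm := measurable_resample hgm
  -- `E` need not be measurable; its measurable hull has the same measure and allows Fubini.
  set D := w ⁻¹' toMeasurable μ E
  have hD : MeasurableSet D := hw.measurable (measurableSet_toMeasurable μ E)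
  have hDle : (μ.prod ν) D ≤ ε / 4 := by
    rw [hw.measure_preimage (measurableSet_toMeasurable μ E).nullMeasurableSet,
      measure_toMeasurable]
    exact hT n
  have hcheb : μ {z | c * √n ≤ |centredSum Q z n g|} ≤ ε / 2 := by
    refine le_trans (le_of_eq ?_) ((measure_deviation_sum_le μ (X := fun j z => g (z j))
      (fun j => hgm.comp (measurable_pi_apply j))
      (iIndepFun_infinitePi (P := fun _ => Q) fun _ => hgm) (fun j z => hg (z j)) hn hc0).trans hc)
    simp [centredSum, μ, integral_eval_infinitePi Q hgm]
  have hsection : {z | ∃ A ∈ 𝔅, (T + 2 + c) * √n < |centredSum Q z n (A.indicator g)|} ⊆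
      {z | c * √n ≤ |centredSum Q z n g|} ∪ {z | 1 / 2 ≤ ν (Prod.mk z ⁻¹' D)} := by
    rintro z ⟨A, hA, hz⟩
    rw [Set.mem_union, or_iff_not_imp_left]
    intro hzc
    have hAm := h𝔅 A hA
    have hXm (j : ℕ) : Measurable fun t : unitInterval × S =>
        A.indicator (fun _ => (1 : ℝ)) (resample g (z j, t)) :=
      (measurable_const.indicator hAm).comp (hrm.comp measurable_prodMk_left)
    have hbd (x : S) : A.indicator (fun _ => (1 : ℝ)) x ∈ Set.Icc (0 : ℝ) 1 := by
      by_cases hx : x ∈ A <;> simp [hx]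
    -- Once `z` is fixed, so is the bad set `A`: no uniformity over `𝔅` is needed here.
    have hch := measure_deviation_sum_le ν
      (X := fun j t => A.indicator (fun _ => (1 : ℝ)) (resample g (z j, t j)))
      (fun j => (hXm j).comp (measurable_pi_apply j))
      (iIndepFun_infinitePi (P := fun _ => τ) hXm) (fun j t => hbd _) hn (zero_lt_two)
    have hint (j : ℕ) : ∫ t, A.indicator (fun _ => (1 : ℝ)) (resample g (z j, t j)) ∂ν
        = A.indicator g (z j) + (1 - g (z j)) * R.real A := by
      rw [← integral_indicator_resample R hgm hg hAm]
      exact integral_eval_infinitePi τ (hXm j) j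
    simp_rw [hint] at hch
    set C := {t : ℕ → unitInterval × S | 2 * √n ≤ |∑ j ∈ Finset.range n,
      A.indicator (fun _ => (1 : ℝ)) (resample g (z j, t j)) -
      ∑ j ∈ Finset.range n, (A.indicator g (z j) + (1 - g (z j)) * R.real A)|}
    have hcover : (Set.univ : Set (ℕ → unitInterval × S)) ⊆ C ∪ Prod.mk z ⁻¹' D := by
      intro t _
      rw [Set.mem_union, or_iff_not_imp_left]
      intro htC
      refine subset_toMeasurable μ E ⟨A, hA, ?_⟩
      simp only [C, Set.mem_ofPred_eq, not_le] at htC hzc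
      have hQA : ∫ x, A.indicator (fun _ => (1 : ℝ)) x ∂Q = Q.real A :=
        integral_indicator_one hAm
      simp only [centredSum, hQA] at hz hzc ⊢
      have hRA : (1 - ∫ x, g x ∂Q) * R.real A = Q.real A - ∫ x, A.indicator g x ∂Q := hR A hAm
      have hQA' : Q.real A = (∫ x, A.indicator g x ∂Q) + (1 - ∫ x, g x ∂Q) * R.real A := by
        linarith
      have hsum : ∑ j ∈ Finset.range n, (A.indicator g (z j) + (1 - g (z j)) * R.real A)
          = ∑ j ∈ Finset.range n, A.indicator g (z j)
            + (n - ∑ j ∈ Finset.range n, g (z j)) * R.real A := by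
        rw [Finset.sum_add_distrib, ← Finset.sum_mul, Finset.sum_sub_distrib]
        simp
      rw [hsum] at htC
      rw [hQA']
      have hr : |(∑ j ∈ Finset.range n, g (z j) - n * ∫ x, g x ∂Q) * R.real A| ≤ c * √n := by
        rw [abs_mul, abs_of_nonneg measureReal_nonneg]
        exact (mul_le_of_le_one_right (abs_nonneg _) measureReal_le_one).trans hzc.le
      simp only [w]
      set s1 := ∑ j ∈ Finset.range n, A.indicator (fun _ => (1 : ℝ)) (resample g (z j, t j))
      set s2 := ∑ j ∈ Finset.range n, A.indicator g (z j)
      set s3 := ∑ j ∈ Finset.range n, g (z j)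
      have htri : s2 - n * ∫ x, A.indicator g x ∂Q
          = (s1 - n * ((∫ x, A.indicator g x ∂Q) + (1 - ∫ x, g x ∂Q) * R.real A))
            - (s1 - (s2 + (n - s3) * R.real A)) + (s3 - n * ∫ x, g x ∂Q) * R.real A := by ring
      rw [htri] at hz
      have h1 := hz.trans_le (abs_add_le _ _)
      have h2 := abs_sub (s1 - n * ((∫ x, A.indicator g x ∂Q) + (1 - ∫ x, g x ∂Q) * R.real A))
        (s1 - (s2 + (n - s3) * R.real A))
      linarith
    -- Chebyshev with constant 2 gives `C` probability at most 1/4, hence at most 1/2.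
    have hone : 1 ≤ 1 / 2 + ν (Prod.mk z ⁻¹' D) := by
      calc (1 : ℝ≥0∞) = ν Set.univ := measure_univ.symm
        _ ≤ ν C + ν (Prod.mk z ⁻¹' D) := (measure_mono hcover).trans (measure_union_le _ _)
        _ ≤ _ := by
          gcongr
          refine hch.trans ?_
          rw [one_div, one_div, ← ENNReal.ofReal_ofNat 2, ← ENNReal.ofReal_inv_of_pos two_pos]
          exact ENNReal.ofReal_le_ofReal (by norm_num)
    have hhalf : (1 : ℝ≥0∞) / 2 + 1 / 2 = 1 := ENNReal.add_halves 1
    exact (ENNReal.add_le_add_iff_left (by norm_num)).1 (hhalf.trans_le hone)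
  have hmarkov : μ {z | 1 / 2 ≤ ν (Prod.mk z ⁻¹' D)} ≤ ε / 2 := by
    have h := mul_meas_ge_le_lintegral (μ := μ) (measurable_measure_prodMk_left (ν := ν) hD) (1 / 2)
    rw [← Measure.prod_apply hD] at h
    calc _ = 2 * (1 / 2 * μ {z | 1 / 2 ≤ ν (Prod.mk z ⁻¹' D)}) := by
          rw [← mul_assoc, one_div, ENNReal.mul_inv_cancel (by norm_num) (by norm_num), one_mul]
      _ ≤ 2 * (ε / 4) := by gcongr; exact h.trans hDle
      _ = ε / 2 := by
        rw [ENNReal.div_eq_inv_mul, ENNReal.div_eq_inv_mul, ← mul_assoc,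
          show (4 : ℝ≥0∞) = 2 * 2 by norm_num, ENNReal.mul_inv (by norm_num) (by norm_num),
          ← mul_assoc, ENNReal.mul_inv_cancel (by norm_num) (by norm_num), one_mul]
  calc _ ≤ ε / 2 + ε / 2 := (measure_mono hsection).trans
        ((measure_union_le _ _).trans (add_le_add hcheb hmarkov))
    _ = ε := ENNReal.add_halves ε

/-- Almost surely no sample point hits the null set where the two functions differ, so the sums
agree for every `A` and `n` at once. -/
theorem IsOuterBounded.congr_ae {Q : Measure S} [IsProbabilityMeasure Q] {𝔅 : Set (Set S)}
    {h h' : S → ℝ} (hh : h =ᵐ[Q] h') (hB : IsOuterBounded Q 𝔅 h) : IsOuterBounded Q 𝔅 h' := by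
  intro ε hε
  obtain ⟨T, hT0, hT⟩ := hB ε hε
  refine ⟨T, hT0, fun n => le_trans (measure_mono_ae ?_) (hT n)⟩
  have hae : ∀ᵐ z ∂(Measure.infinitePi fun _ : ℕ => Q), ∀ j, h (z j) = h' (z j) :=
    ae_all_iff.2 fun j =>
      (measurePreserving_eval_infinitePi (fun _ : ℕ => Q) j).quasiMeasurePreserving.ae hh
  filter_upwards [hae] with z hz
  rintro ⟨A, hA, hzA⟩
  refine ⟨A, hA, ?_⟩
  have h1 : ∫ x, A.indicator h x ∂Q = ∫ x, A.indicator h' x ∂Q :=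
    integral_congr_ae (hh.mono fun x hx => by by_cases hxA : x ∈ A <;> simp [hxA, hx])
  have h2 (j : ℕ) : A.indicator h (z j) = A.indicator h' (z j) := by
    by_cases hxA : z j ∈ A <;> simp [hxA, hz j]
  simpa only [centredSum, h1, h2] using hzA

/-- Multiplication by a fixed essentially bounded function preserves boundedness in outer
probability of the empirical process of a class of sets. -/
theorem IsOuterBounded.of_bounded {Q : Measure S} [IsProbabilityMeasure Q] {𝔅 : Set (Set S)}
    (h𝔅 : ∀ A ∈ 𝔅, MeasurableSet A) (hB : IsOuterBounded Q 𝔅 fun _ => 1) {h : S → ℝ}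
    (hm : Measurable h) {M : ℝ} (hM : 0 < M) (hh : ∀ᵐ x ∂Q, |h x| ≤ M) :
    IsOuterBounded Q 𝔅 h := by
  -- Truncation makes the essential bound hold everywhere.
  set h' : S → ℝ := fun x => max (-M) (min M (h x))
  have hh' : h' =ᵐ[Q] h := hh.mono fun x hx => by
    simp only [h']
    rw [min_eq_right (abs_le.1 hx).2, max_eq_right (abs_le.1 hx).1]
  refine IsOuterBounded.congr_ae hh' ?_
  have hb' (x : S) : -M ≤ h' x ∧ h' x ≤ M :=
    ⟨le_max_left _ _, max_le (by linarith) (min_le_left _ _)⟩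
  -- Dividing by `4 * M` rather than `2 * M` keeps `g ≤ 1/2`, hence `∫ g < 1`, so that the
  -- replacement law exists.
  set g : S → ℝ := fun x => (h' x + M) / (4 * M)
  have hgm : Measurable g := by fun_prop
  have hg (x : S) : g x ∈ Set.Icc (0 : ℝ) (1 / 2) := by
    refine ⟨div_nonneg (by linarith [(hb' x).1]) (by positivity), ?_⟩
    rw [div_le_iff₀ (by positivity)]
    linarith [(hb' x).2]
  have hgi : Integrable g Q :=
    (memLp_of_bounded (.of_forall hg) hgm.aestronglyMeasurable 1).integrable le_rfl
  have hg1 : ∫ x, g x ∂Q < 1 := by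
    have : ∫ x, g x ∂Q ≤ ∫ _x, (1 / 2 : ℝ) ∂Q :=
      integral_mono hgi (integrable_const _) fun x => (hg x).2
    simp only [integral_const, probReal_univ, one_smul] at this
    linarith
  have hG : IsOuterBounded Q 𝔅 g := IsOuterBounded.of_mem_Icc h𝔅 hB hgm
    (fun x => ⟨(hg x).1, (hg x).2.trans (by norm_num)⟩) hg1
  intro ε hε
  obtain ⟨T₁, hT₁, h₁⟩ := hG (ε / 2) (ENNReal.half_pos hε.ne')
  obtain ⟨T₂, hT₂, h₂⟩ := hB (ε / 2) (ENNReal.half_pos hε.ne')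
  refine ⟨4 * M * T₁ + M * T₂, by positivity, fun n => ?_⟩
  rw [← ENNReal.add_halves ε]
  refine le_trans (measure_mono ?_) ((measure_union_le _ _).trans (add_le_add (h₁ n) (h₂ n)))
  rintro z ⟨A, hA, hz⟩
  by_contra hcon
  simp only [Set.mem_union, Set.mem_ofPred_eq, not_or, not_exists, not_and, not_lt] at hcon
  have e₁ := hcon.1 A hA
  have e₂ := hcon.2 A hA
  have hdec (x : S) : A.indicator h' x
      = 4 * M * A.indicator g x - M * A.indicator (fun _ => 1) x := by
    by_cases hx : x ∈ A
    · simp only [hx, Set.indicator_of_mem, g]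
      field_simp
      ring
    · simp [hx]
  have hlin : centredSum Q z n (A.indicator h') = 4 * M * centredSum Q z n (A.indicator g)
      - M * centredSum Q z n (A.indicator fun _ => 1) := by
    simp only [centredSum, hdec]
    rw [integral_sub ((hgi.indicator (h𝔅 A hA)).const_mul _)
      (((integrable_const 1).indicator (h𝔅 A hA)).const_mul _), integral_const_mul,
      integral_const_mul, Finset.sum_sub_distrib, ← Finset.mul_sum, ← Finset.mul_sum]
    ring
  rw [hlin] at hz
  have h3 := hz.trans_le (abs_sub _ _)
  rw [abs_mul (4 * M), abs_mul M, abs_of_pos (by positivity : 0 < 4 * M), abs_of_pos hM] at h3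
  nlinarith

end Bounded

/-! ### Boundedness in outer probability from the Donsker property -/

section Donsker

/-- Markov's inequality for the outer expectation of a nonnegative function. -/
theorem measure_one_le_of_outerExp_lt {Ω : Type*} [MeasurableSpace Ω] {P : Measure Ω}
    [IsProbabilityMeasure P] {f : Ω → ℝ} (hf0 : ∀ ω, 0 ≤ f ω) (hf1 : ∀ ω, f ω ≤ 1) {r : ℝ}
    (hr : outerExp P f < r) : P {ω | 1 ≤ f ω} ≤ ENNReal.ofReal r := by
  have hne : {r : ℝ | ∃ U : Ω → ℝ, Measurable U ∧ Integrable U P ∧ (∀ ω, f ω ≤ U ω) ∧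
      ∫ ω, U ω ∂P = r}.Nonempty :=
    ⟨_, fun _ => (1 : ℝ), measurable_const, integrable_const 1, hf1, rfl⟩
  obtain ⟨_, ⟨U, hUm, hUi, hfU, rfl⟩, hUr⟩ := exists_lt_of_csInf_lt hne hr
  have hU0 : 0 ≤ᵐ[P] U := .of_forall fun ω => (hf0 ω).trans (hfU ω)
  have h := mul_meas_ge_le_integral_of_nonneg hU0 hUi 1
  rw [one_mul] at h
  calc P {ω | 1 ≤ f ω} ≤ P {ω | 1 ≤ U ω} := measure_mono fun ω hω => hω.trans (hfU ω)
    _ = ENNReal.ofReal (P.real {ω | 1 ≤ U ω}) := by rw [ofReal_measureReal]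
    _ ≤ _ := ENNReal.ofReal_le_ofReal (h.trans hUr.le)

/-- A sequence which converges in distribution to a tight law is eventually bounded in outer
probability. -/
theorem OuterTendstoInLaw.eventually_measure_norm_le {Ω D : Type*} [MeasurableSpace Ω]
    [NormedAddCommGroup D] [MeasurableSpace D] [BorelSpace D] {P : Measure Ω}
    [IsProbabilityMeasure P] {M : ℕ → Ω → D} {μ : Measure D} [IsProbabilityMeasure μ]
    (hμ : IsTightMeasureSet {μ}) (hM : OuterTendstoInLaw P M μ) {ε : ℝ≥0∞} (hε : 0 < ε) :
    ∃ T : ℝ, ∀ᶠ n in atTop, P {ω | T < ‖M n ω‖} ≤ ε := by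
  obtain ⟨δ, hδ0, hδε⟩ : ∃ δ : ℝ, 0 < δ ∧ ENNReal.ofReal δ ≤ ε := by
    obtain ⟨δ, hδ0, hδ⟩ := ENNReal.lt_iff_exists_nnreal_btwn.1 hε
    exact ⟨δ, by simpa using hδ0, by simpa using hδ.le⟩
  obtain ⟨K, hK, hKμ⟩ := isTightMeasureSet_iff_exists_isCompact_measure_compl_le.1 hμ
    (ENNReal.ofReal (δ / 2)) (by simpa using hδ0)
  obtain ⟨R, hR⟩ := hK.isBounded.exists_norm_le
  -- A continuous cutoff: zero on `K`, one where the norm is at least `R + 1`.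
  set φ : D → ℝ := fun x => max 0 (min 1 (‖x‖ - R))
  have hφ0 (x : D) : 0 ≤ φ x := le_max_left _ _
  have hφ1 (x : D) : φ x ≤ 1 := max_le zero_le_one (min_le_left _ _)
  have hφc : Continuous φ := by fun_prop
  set h : D →ᵇ ℝ := BoundedContinuousFunction.ofNormedAddCommGroup φ hφc 1 fun x => by
    rw [Real.norm_of_nonneg (hφ0 x)]; exact hφ1 x
  have hint : ∫ y, h y ∂μ ≤ δ / 2 := by
    have hle : ∀ x, φ x ≤ Kᶜ.indicator (fun _ => (1 : ℝ)) x := fun x => by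
      by_cases hx : x ∈ K
      · have := hR x hx
        simp only [Set.indicator_of_notMem (Set.notMem_compl_iff.2 hx), φ]
        exact max_le le_rfl ((min_le_right _ _).trans (by linarith))
      · rw [Set.indicator_of_mem (Set.mem_compl hx)]
        exact hφ1 x
    have hKm : MeasurableSet Kᶜ := hK.isClosed.measurableSet.compl
    calc ∫ y, h y ∂μ ≤ ∫ y, Kᶜ.indicator (fun _ => (1 : ℝ)) y ∂μ :=
          integral_mono (h.integrable μ) ((integrable_const 1).indicator hKm) hle
      _ = μ.real Kᶜ := integral_indicator_one hKm
      _ ≤ δ / 2 := ENNReal.toReal_le_of_le_ofReal (by positivity) (hKμ μ rfl)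
  refine ⟨R + 1, ?_⟩
  filter_upwards [(hM h).eventually_lt_const (hint.trans_lt (half_lt_self hδ0))] with n hn
  refine le_trans (measure_mono fun ω hω => ?_)
    ((measure_one_le_of_outerExp_lt (fun ω => hφ0 _) (fun ω => hφ1 _) hn).trans hδε)
  simp only [Set.mem_ofPred_eq] at hω
  have h1 : 1 ≤ ‖M n ω‖ - R := by linarith
  exact le_max_of_le_right (le_min le_rfl h1)

/-- Convergence in law controls all `n ≥ N`. For `n < N` the deviation is at most `n ≤ √N √n`, which
explains the `√N` in the bound. -/
theorem IsDonskerSets.isOuterBounded {S : Type*} [MeasurableSpace S] {Q : Measure S}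
    [IsProbabilityMeasure Q] {𝔅 : Set (Set S)} (h𝔅 : ∀ A ∈ 𝔅, MeasurableSet A)
    (hD : IsDonskerSets Q 𝔅) :
    IsOuterBounded Q 𝔅 fun _ => 1 := by
  obtain ⟨-, G, hG, μ, hμp, hμt, hlaw⟩ := hD
  intro ε hε
  let _ : MeasurableSpace (EllInfty {f | ∃ A ∈ 𝔅, f = A.indicator fun _ => (1 : ℝ)}) := borel _
  have : BorelSpace (EllInfty {f | ∃ A ∈ 𝔅, f = A.indicator fun _ => (1 : ℝ)}) := ⟨rfl⟩
  obtain ⟨T, hT⟩ := hlaw.eventually_measure_norm_le hμt hε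
  obtain ⟨N, hN⟩ := eventually_atTop.1 hT
  refine ⟨max T √N, (Real.sqrt_nonneg _).trans (le_max_right _ _), fun n => ?_⟩
  rcases le_or_gt N n with hNn | hNn
  · refine le_trans (measure_mono ?_) (hN n hNn)
    rintro z ⟨A, hA, hz⟩
    rcases eq_or_ne n 0 with rfl | hn
    · simp [centredSum] at hz
    have hn' : (0 : ℝ) < n := by positivity
    have h1 := hG n z ⟨A.indicator fun _ => 1, A, hA, rfl⟩
    have h2 : centredSum Q z n (A.indicator fun _ => 1)
        = √n * empProcess Q z n (A.indicator fun _ => 1) := by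
      rw [centredSum, empProcess, empMean, ← mul_assoc, Real.mul_self_sqrt hn'.le]
      field_simp
    rw [h2, abs_mul, abs_of_nonneg (Real.sqrt_nonneg _), mul_comm] at hz
    have h3 := lt_of_mul_lt_mul_left hz (Real.sqrt_nonneg _)
    have h4 := lp.norm_apply_le_norm ENNReal.top_ne_zero (G n z) ⟨A.indicator fun _ => 1, A, hA, rfl⟩
    rw [h1, Real.norm_eq_abs] at h4
    exact (le_max_left _ _).trans_lt (h3.trans_le h4)
  · refine le_of_eq_of_le (measure_mono_null ?_ measure_empty) zero_le
    rintro z ⟨A, hA, hz⟩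
    exfalso
    have hs0 : 0 ≤ ∑ j ∈ Finset.range n, A.indicator (fun _ => (1 : ℝ)) (z j) :=
      Finset.sum_nonneg fun j _ => Set.indicator_nonneg (fun _ _ => zero_le_one) _
    have hs1 : ∑ j ∈ Finset.range n, A.indicator (fun _ => (1 : ℝ)) (z j) ≤ n := by
      calc _ ≤ ∑ j ∈ Finset.range n, (1 : ℝ) :=
            Finset.sum_le_sum fun j _ => Set.indicator_le_self' (fun _ _ => zero_le_one) _
        _ = n := by simp
    have hi : ∫ x, A.indicator (fun _ => (1 : ℝ)) x ∂Q = Q.real A :=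
      integral_indicator_one (h𝔅 A hA)
    have hle : |centredSum Q z n (A.indicator fun _ => 1)| ≤ n := by
      have hp0 : 0 ≤ n * Q.real A := by positivity
      have hp1 : n * Q.real A ≤ n := mul_le_of_le_one_right (by positivity) measureReal_le_one
      rw [centredSum, hi, abs_le]
      constructor <;> linarith
    have hsq : (n : ℝ) ≤ max T √N * √n := by
      calc (n : ℝ) = √n * √n := (Real.mul_self_sqrt (by positivity)).symm
        _ ≤ _ := by
          gcongr
          exact le_max_of_le_right (Real.sqrt_le_sqrt (by exact_mod_cast hNn.le))
    linarith

/-- Boundedness in outer probability carries over to i.i.d. samples on any probability space. -/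
theorem IsOuterBounded.exists_measure_le {S : Type*} [MeasurableSpace S] {Q : Measure S}
    [IsProbabilityMeasure Q] {𝔅 : Set (Set S)} {h : S → ℝ} (hB : IsOuterBounded Q 𝔅 h)
    {Ω : Type*} [MeasurableSpace Ω] {P : Measure Ω} {Z : ℕ → Ω → S} (hZ : ∀ j, Measurable (Z j))
    (hZQ : ∀ j, P.map (Z j) = Q) (hZind : iIndepFun Z P) {ε : ℝ≥0∞} (hε : 0 < ε) :
    ∃ T : ℝ, 0 ≤ T ∧ ∀ n : ℕ, P {ω | ∃ A ∈ 𝔅,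
      T * √n < |centredSum Q (fun j => Z j ω) n (A.indicator h)|} ≤ ε := by
  obtain ⟨T, hT0, hT⟩ := hB ε hε
  refine ⟨T, hT0, fun n => le_trans ?_ (hT n)⟩
  have hmap : P.map (fun ω j => Z j ω) = Measure.infinitePi fun _ => Q := by
    rw [hZind.map_fun_eq_infinitePi_map hZ]
    simp_rw [hZQ]
  rw [← hmap]
  -- For non-measurable sets only this inequality is available in general, and it is the direction
  -- needed.
  exact Measure.le_map_apply (by fun_prop) _

end Donsker

/-! ### Deterministic estimates for conditional means -/

section Conditional

theorem isBigOOuter_of_measure_le {Ω : Type*} [MeasurableSpace Ω] {P : Measure Ω}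
    {M : ℕ → Ω → ℝ} {a : ℕ → ℝ} (ha : ∀ n ≠ 0, 0 < a n)
    (h : ∀ ε : ℝ≥0∞, 0 < ε → ∃ C : ℝ, ∀ n ≠ 0, P {ω | C * a n < |M n ω|} ≤ ε) :
    IsBigOOuter P M a := by
  intro ε hε
  obtain ⟨ε', hε', hlt⟩ := exists_between hε
  obtain ⟨C, hC⟩ := h ε' hε'
  refine ⟨Metric.closedBall 0 C, isCompact_closedBall _ _, fun δ hδ => lt_of_le_of_lt ?_ hlt⟩
  refine limsup_le_of_le (by isBoundedDefault) ?_
  filter_upwards [eventually_ne_atTop 0] with n hn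
  rw [outerProb_eq]
  refine le_trans (measure_mono fun ω hω => ?_) (hC n hn)
  by_contra hcon
  simp only [Set.mem_ofPred_eq, not_lt] at hcon
  refine hω (Metric.self_subset_thickening hδ _ ?_)
  rw [mem_closedBall_zero_iff, Real.norm_eq_abs, abs_div, abs_of_pos (ha n hn),
    div_le_iff₀ (ha n hn)]
  exact hcon

theorem condE_eq_of_map {Ω E : Type*} [MeasurableSpace Ω] [MeasurableSpace E] {P : Measure Ω}
    {Q : Measure (E × ℝ)} {X : Ω → E} {Y : Ω → ℝ} (hX : Measurable X) (hY : Measurable Y)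
    (hQ : P.map (fun ω => (X ω, Y ω)) = Q) {h : ℝ → ℝ} (hh : Measurable h) {A : Set (E × ℝ)}
    (hA : MeasurableSet A) :
    condE P (fun ω => (X ω, Y ω)) Y h A = (∫ w, A.indicator (fun w => h w.2) w ∂Q) / Q.real A := by
  have hW : Measurable fun ω => (X ω, Y ω) := hX.prodMk hY
  have hm : Measurable (A.indicator fun w : E × ℝ => h w.2) :=
    (hh.comp measurable_snd).indicator hA
  rw [← hQ, integral_map hW.aemeasurable hm.aestronglyMeasurable,
    map_measureReal_apply hW hA]
  rfl

/-- A ratio of sums compared with a ratio of integrals. -/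
theorem abs_div_sub_le {s q r p M K₁ K₂ : ℝ} {N : ℝ} (hq : 0 < q) (hp : 0 ≤ p)
    (hr : |r| ≤ M * p) (hM : 0 ≤ M) (h₁ : |q - N * p| ≤ K₁) (h₂ : |s - N * r| ≤ K₂) :
    |s / q - r / p| ≤ (K₂ + M * K₁) / q := by
  -- If `p = 0` then `r = 0`, and `r / p = 0` by convention, so `e = 0` serves.
  obtain ⟨e, he, hre⟩ : ∃ e, |e| ≤ M ∧ r = e * p ∧ r / p = e := by
    rcases hp.eq_or_lt with rfl | hp
    · exact ⟨0, by simpa, by simpa using hr, by simp⟩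
    · exact ⟨r / p, by rwa [abs_div, abs_of_pos hp, div_le_iff₀ hp], by field_simp, rfl⟩
  rw [hre.2]
  -- As `r = e * p`, the terms in `N` cancel. Only `q` is left in the denominator, so no lower bound
  -- on `p` is required.
  have : s / q - e = ((s - N * r) - e * (q - N * p)) / q := by
    rw [hre.1]; field_simp; ring
  rw [this, abs_div, abs_of_pos hq]
  gcongr
  refine (abs_sub _ _).trans (add_le_add h₂ ?_)
  rw [abs_mul]
  exact mul_le_mul he h₁ (abs_nonneg _) hM

/-- The bound `n * n^(-α)` is split so that dividing a deviation of order `√n` by it leaves `n^(α -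
1/2)`. -/
theorem rpow_mul_sqrt_le_sum {S : Type*} {𝔅 : Set (Set S)} {α : ℝ} {z : ℕ → S} {n : ℕ}
    (hn : n ≠ 0) {A : Set S} (hA : A ∈ frequentSets 𝔅 α z n) :
    (n : ℝ) ^ (1 / 2 - α) * √n ≤ ∑ j ∈ Finset.range n, A.indicator (fun _ => (1 : ℝ)) (z j) := by
  have hn' : (0 : ℝ) < n := by positivity
  have h := hA.2
  rw [empMeasure, empMean, le_div_iff₀ hn'] at h
  refine le_of_eq_of_le ?_ h
  rw [Real.sqrt_eq_rpow, ← Real.rpow_add hn', ← Real.rpow_add_one hn'.ne']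
  congr 1
  ring

theorem abs_integral_indicator_le {S : Type*} [MeasurableSpace S] {Q : Measure S}
    [IsProbabilityMeasure Q] {A : Set S} (hA : MeasurableSet A) {h : S → ℝ} {M : ℝ}
    (hh : ∀ᵐ x ∂Q, |h x| ≤ M) : |∫ x, A.indicator h x ∂Q| ≤ M * Q.real A := by
  rw [integral_indicator hA, ← Real.norm_eq_abs]
  exact norm_setIntegral_le_of_norm_le_const_ae (measure_lt_top _ _) (ae_restrict_of_ae hh)

/-- On the event that the empirical process indexed by `1_A` and `h 1_A` is bounded, empirical
conditional expectations given frequent sets are close to the true ones. -/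
theorem abs_empCondE_sub_le {E : Type*} [MeasurableSpace E] {Q : Measure (E × ℝ)}
    [IsProbabilityMeasure Q] {𝔅 : Set (Set (E × ℝ))} {α : ℝ} {z : ℕ → E × ℝ} {n : ℕ}
    (hn : n ≠ 0) {A : Set (E × ℝ)} (hAm : MeasurableSet A) (hA : A ∈ frequentSets 𝔅 α z n)
    {h : ℝ → ℝ} {M T₁ T₂ : ℝ} (hM : 0 ≤ M) (hh : ∀ᵐ w ∂Q, |h w.2| ≤ M)
    (hT₁ : 0 ≤ T₁) (hT₂ : 0 ≤ T₂)
    (h₁ : |centredSum Q z n (A.indicator fun _ => 1)| ≤ T₁ * √n)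
    (h₂ : |centredSum Q z n (A.indicator fun w => h w.2)| ≤ T₂ * √n) :
    |empCondE z n h A - (∫ w, A.indicator (fun w => h w.2) w ∂Q) / Q.real A|
      ≤ (T₂ + M * T₁) * (n : ℝ) ^ (α - 1 / 2) := by
  have hn' : (0 : ℝ) < n := by positivity
  have hq := rpow_mul_sqrt_le_sum hn hA
  have hpos : 0 < (n : ℝ) ^ (1 / 2 - α) * √n := by positivity
  have hi : ∫ x, A.indicator (fun _ => (1 : ℝ)) x ∂Q = Q.real A := integral_indicator_one hAm
  rw [centredSum, hi] at h₁
  refine (abs_div_sub_le (hpos.trans_le hq) measureReal_nonneg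
    (abs_integral_indicator_le hAm hh) hM h₁ h₂).trans ?_
  rw [div_le_iff₀ (hpos.trans_le hq)]
  calc T₂ * √n + M * (T₁ * √n)
      = (T₂ + M * T₁) * (n : ℝ) ^ (α - 1 / 2) * ((n : ℝ) ^ (1 / 2 - α) * √n) := by
        have : (n : ℝ) ^ (α - 1 / 2) * (n : ℝ) ^ (1 / 2 - α) = 1 := by
          rw [← Real.rpow_add hn']; simp
        linear_combination (-(T₂ + M * T₁) * √n) * this
    _ ≤ _ := by gcongr

theorem abs_empCondE_le {E : Type*} {z : ℕ → E × ℝ} {n : ℕ} {A : Set (E × ℝ)} {h : ℝ → ℝ} {M : ℝ}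
    (hM : 0 ≤ M) (hz : ∀ j, |h (z j).2| ≤ M) : |empCondE z n h A| ≤ M := by
  rw [empCondE, abs_div]
  have h0 : 0 ≤ ∑ j ∈ Finset.range n, A.indicator (fun _ => (1 : ℝ)) (z j) :=
    Finset.sum_nonneg fun j _ => Set.indicator_nonneg (fun _ _ => zero_le_one) _
  rw [abs_of_nonneg h0]
  refine div_le_of_le_mul₀ h0 hM ((Finset.abs_sum_le_sum_abs _ _).trans ?_)
  rw [Finset.mul_sum]
  refine Finset.sum_le_sum fun j _ => ?_
  by_cases hj : z j ∈ A <;> simp [hj, hz j]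

end Conditional

/-! ### Uniform rates over the frequent sets -/

section Sample

variable {Ω : Type*} [MeasurableSpace Ω] {P : Measure Ω} {S : Type*} {𝔅 : Set (Set S)} {α : ℝ}

/-- A uniform rate over the frequent sets, off events of small outer probability. -/
def HasFrequentRate (P : Measure Ω) (𝔅 : Set (Set S)) (α : ℝ) (Z : ℕ → Ω → S)
    (F : ℕ → Ω → Set S → ℝ) : Prop :=
  ∀ ε : ℝ≥0∞, 0 < ε → ∃ C : ℝ, 0 ≤ C ∧ ∀ n ≠ 0,
    P {ω | ∃ A ∈ frequentSets 𝔅 α (fun j => Z j ω) n,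
      C * (n : ℝ) ^ (α - 1 / 2) < |F n ω A|} ≤ ε

theorem HasFrequentRate.isBigOOuter_iSup {Z : ℕ → Ω → S} {F : ℕ → Ω → Set S → ℝ}
    (hF : HasFrequentRate P 𝔅 α Z F) :
    IsBigOOuter P (fun n ω => ⨆ A : frequentSets 𝔅 α (fun j => Z j ω) n, |F n ω A|)
      (fun n => (n : ℝ) ^ (α - 1 / 2)) := by
  have ha (n : ℕ) (hn : n ≠ 0) : (0 : ℝ) < (n : ℝ) ^ (α - 1 / 2) := by positivity
  refine isBigOOuter_of_measure_le ha fun ε hε => ?_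
  obtain ⟨C, hC0, hC⟩ := hF ε hε
  refine ⟨C, fun n hn => le_trans (measure_mono fun ω hω => ?_) (hC n hn)⟩
  by_contra hcon
  simp only [Set.mem_ofPred_eq, not_exists, not_and, not_lt] at hcon hω
  rw [abs_of_nonneg (Real.iSup_nonneg fun _ => abs_nonneg _)] at hω
  -- Nonnegativity of the bound covers the empty family, whose supremum is 0.
  exact absurd hω (not_lt.2 (Real.iSup_le (fun A => hcon A A.2)
    (mul_nonneg hC0 (ha n hn).le)))

/-- If `Q(A) = 0`, the centred sum is the count itself, at least `n^(1/2 - α) √n` for frequent `A`.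
As `α < 1/2`, this eventually exceeds `T √n`. -/
theorem tendsto_outerProb_exists_measure_eq_zero [MeasurableSpace S] {Q : Measure S}
    [IsProbabilityMeasure Q] (h𝔅 : ∀ A ∈ 𝔅, MeasurableSet A)
    (hB : IsOuterBounded Q 𝔅 fun _ => 1) {Z : ℕ → Ω → S} (hZ : ∀ j, Measurable (Z j))
    (hZQ : ∀ j, P.map (Z j) = Q) (hZind : iIndepFun Z P) (hα : α < 1 / 2) :
    Tendsto (fun n : ℕ => outerProb P
      {ω | ∃ A ∈ frequentSets 𝔅 α (fun j => Z j ω) n, Q A = 0}) atTop (𝓝 0) := by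
  refine ENNReal.tendsto_nhds_zero.2 fun ε hε => ?_
  obtain ⟨T, hT0, hT⟩ := hB.exists_measure_le hZ hZQ hZind hε
  have hlim : Tendsto (fun n : ℕ => (n : ℝ) ^ (1 / 2 - α)) atTop atTop :=
    (tendsto_rpow_atTop (by linarith)).comp tendsto_natCast_atTop_atTop
  filter_upwards [hlim.eventually_gt_atTop T, eventually_ne_atTop 0] with n hn hn0
  rw [outerProb_eq]
  refine le_trans (measure_mono ?_) (hT n)
  rintro ω ⟨A, hA, hA0⟩
  refine ⟨A, hA.1, ?_⟩
  have hi : ∫ x, A.indicator (fun _ => (1 : ℝ)) x ∂Q = 0 := by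
    rw [integral_indicator (h𝔅 A hA.1), setIntegral_measure_zero _ hA0]
  rw [centredSum, hi, mul_zero, sub_zero]
  have hn' : 0 < √(n : ℝ) := by positivity
  exact ((mul_lt_mul_of_pos_right hn hn').trans_le (rpow_mul_sqrt_le_sum hn0 hA)).trans_le
    (le_abs_self _)

variable {E : Type*} [MeasurableSpace E] {Q : Measure (E × ℝ)}
  {𝔅 : Set (Set (E × ℝ))} {Z : ℕ → Ω → E × ℝ}

theorem hasFrequentRate_empCondE [IsProbabilityMeasure Q] (h𝔅 : ∀ A ∈ 𝔅, MeasurableSet A)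
    (hB : IsOuterBounded Q 𝔅 fun _ => 1) (hZ : ∀ j, Measurable (Z j))
    (hZQ : ∀ j, P.map (Z j) = Q) (hZind : iIndepFun Z P) {h : ℝ → ℝ} (hm : Measurable h) {M : ℝ}
    (hM : 0 < M) (hh : ∀ᵐ w ∂Q, |h w.2| ≤ M) :
    HasFrequentRate P 𝔅 α Z fun n ω A => empCondE (fun j => Z j ω) n h A
      - (∫ w, A.indicator (fun w => h w.2) w ∂Q) / Q.real A := by
  intro ε hε
  obtain ⟨T₁, hT₁, h₁⟩ := hB.exists_measure_le hZ hZQ hZind (ENNReal.half_pos hε.ne')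
  obtain ⟨T₂, hT₂, h₂⟩ := (hB.of_bounded h𝔅 (h := fun w => h w.2) (by fun_prop)
    hM hh).exists_measure_le hZ hZQ hZind (ENNReal.half_pos hε.ne')
  refine ⟨T₂ + M * T₁, by positivity, fun n hn => ?_⟩
  rw [← ENNReal.add_halves ε]
  refine le_trans (measure_mono ?_) ((measure_union_le _ _).trans (add_le_add (h₁ n) (h₂ n)))
  rintro ω ⟨A, hA, hω⟩
  by_contra hcon
  simp only [Set.mem_union, Set.mem_ofPred_eq, not_or, not_exists, not_and, not_lt] at hcon
  exact absurd hω (not_lt.2 (abs_empCondE_sub_le hn (h𝔅 A hA.1) hA hM.le hh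
    hT₁ hT₂ (hcon.1 A hA.1) (hcon.2 A hA.1)))

/-- The difference of squared means factors as `(x - y) * (x + y)`, where `|x + y| ≤ 2 * M` because
almost surely all sampled `Y_j` are bounded by `M`. -/
theorem hasFrequentRate_empCondV (hZ : ∀ j, Measurable (Z j))
    (hZQ : ∀ j, P.map (Z j) = Q) {M : ℝ} (hM0 : 0 < M) (hMQ : ∀ᵐ w ∂Q, |w.2| ≤ M)
    {m₁ m₂ : Set (E × ℝ) → ℝ} (hm₁ : ∀ A ∈ 𝔅, |m₁ A| ≤ M)
    (hr₁ : HasFrequentRate P 𝔅 α Z fun n ω A =>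
      empCondE (fun j => Z j ω) n (fun y => y) A - m₁ A)
    (hr₂ : HasFrequentRate P 𝔅 α Z fun n ω A =>
      empCondE (fun j => Z j ω) n (fun y => y ^ 2) A - m₂ A) :
    HasFrequentRate P 𝔅 α Z fun n ω A =>
      empCondV (fun j => Z j ω) n A - (m₂ A - m₁ A ^ 2) := by
  intro ε hε
  have ha (n : ℕ) (hn : n ≠ 0) : (0 : ℝ) < (n : ℝ) ^ (α - 1 / 2) := by positivity
  obtain ⟨C₁, hC₁, h₁⟩ := hr₁ _ (ENNReal.half_pos hε.ne')
  obtain ⟨C₂, hC₂, h₂⟩ := hr₂ _ (ENNReal.half_pos hε.ne')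
  refine ⟨C₂ + 2 * M * C₁, by positivity, fun n hn => ?_⟩
  rw [← ENNReal.add_halves ε]
  refine le_trans (measure_mono_ae ?_)
    ((measure_union_le _ _).trans (add_le_add (h₁ n hn) (h₂ n hn)))
  have hae : ∀ᵐ ω ∂P, ∀ j, |(Z j ω).2| ≤ M := ae_all_iff.2 fun j =>
    ae_of_ae_map (hZ j).aemeasurable ((hZQ j).symm ▸ hMQ)
  filter_upwards [hae] with ω hω
  rintro ⟨A, hA, hlt⟩
  by_contra hcon
  obtain ⟨e₁, e₂⟩ := not_or.1 hcon
  simp only [Set.mem_ofPred_eq, not_exists, not_and, not_lt] at e₁ e₂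
  replace e₁ := e₁ A hA
  replace e₂ := e₂ A hA
  have b₁ : |empCondE (fun j => Z j ω) n (fun y => y) A| ≤ M := abs_empCondE_le hM0.le hω
  have b₂ := hm₁ A hA.1
  simp only [empCondV] at hlt
  set x := empCondE (fun j => Z j ω) n (fun y => y) A
  set y := m₁ A
  set u := empCondE (fun j => Z j ω) n (fun y => y ^ 2) A
  set v := m₂ A
  have hdec : u - x ^ 2 - (v - y ^ 2) = (u - v) - (x - y) * (x + y) := by ring
  have hxy : |x + y| ≤ 2 * M := (abs_add_le _ _).trans (by linarith)
  have hprod : |x - y| * |x + y| ≤ C₁ * (n : ℝ) ^ (α - 1 / 2) * (2 * M) :=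
    mul_le_mul e₁ hxy (abs_nonneg _) (mul_nonneg hC₁ (ha n hn).le)
  rw [hdec] at hlt
  have h3 := hlt.trans_le (abs_sub _ _)
  rw [abs_mul] at h3
  linarith

end Sample

theorem corollary1 {Ω : Type*} [MeasurableSpace Ω] (P : Measure Ω) [IsProbabilityMeasure P]
    {d : ℕ} (Q : Measure (EuclideanSpace ℝ (Fin d) × ℝ)) [IsProbabilityMeasure Q]
    -- the pair `(X, Y)` with law `Q`
    (X : Ω → EuclideanSpace ℝ (Fin d)) (Y : Ω → ℝ) (hX : Measurable X) (hY : Measurable Y)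
    (hQ : P.map (fun ω => (X ω, Y ω)) = Q)
    -- the i.i.d. sample `Z j = (X_j, Y_j)` with law `Q`
    (Z : ℕ → Ω → EuclideanSpace ℝ (Fin d) × ℝ) (hZ : ∀ j, Measurable (Z j))
    (hZQ : ∀ j, P.map (Z j) = Q) (hZind : iIndepFun Z P)
    -- `Y` is bounded
    (L : ℝ) (hYL : ∀ᵐ ω ∂P, |Y ω| ≤ L)
    -- a `Q`-Donsker class of Borel sets
    (𝔅 : Set (Set (EuclideanSpace ℝ (Fin d) × ℝ))) (h𝔅 : ∀ A ∈ 𝔅, MeasurableSet A)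
    (hD : IsDonskerSets Q 𝔅)
    (α : ℝ) (hα0 : 0 ≤ α) (hα : α < 1 / 2) :
    -- with outer probability tending to one, `Q(A) > 0` for all `A ∈ 𝔅_n`
    Tendsto (fun n : ℕ => outerProb P
      {ω | ∃ A ∈ frequentSets 𝔅 α (fun j => Z j ω) n, Q A = 0}) atTop (𝓝 0) ∧
    -- conditional moments
    (∀ i : ℕ, IsBigOOuter P
      (fun n ω => ⨆ A : frequentSets 𝔅 α (fun j => Z j ω) n,
        |empCondE (fun j => Z j ω) n (fun y => y ^ i) A
          - condE P (fun ω' => (X ω', Y ω')) Y (fun y => y ^ i) A|)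
      (fun n => (n : ℝ) ^ (α - 1 / 2))) ∧
    -- conditional variances
    IsBigOOuter P
      (fun n ω => ⨆ A : frequentSets 𝔅 α (fun j => Z j ω) n,
        |empCondV (fun j => Z j ω) n A - condV P (fun ω' => (X ω', Y ω')) Y A|)
      (fun n => (n : ℝ) ^ (α - 1 / 2)) := by
  have hB := hD.isOuterBounded h𝔅
  have hcE {h : ℝ → ℝ} (hh : Measurable h) {A : Set (EuclideanSpace ℝ (Fin d) × ℝ)}
      (hA : A ∈ 𝔅) := condE_eq_of_map hX hY hQ hh (h𝔅 A hA)
  obtain ⟨M, hM1, hMQ⟩ : ∃ M : ℝ, 1 ≤ M ∧ ∀ᵐ w ∂Q, |w.2| ≤ M := by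
    -- The maximum with 1 makes `M` and all its powers positive, whatever `L` is.
    refine ⟨max 1 L, le_max_left _ _, ?_⟩
    rw [← hQ, ae_map_iff (hX.prodMk hY).aemeasurable
      (measurableSet_le (by fun_prop) measurable_const)]
    exact hYL.mono fun ω hω => hω.trans (le_max_right _ _)
  have hM0 : 0 < M := by linarith
  have hpow (i : ℕ) : ∀ᵐ w ∂Q, |w.2 ^ i| ≤ M ^ i := hMQ.mono fun w hw => by
    rw [abs_pow]
    exact pow_le_pow_left₀ (abs_nonneg _) hw i
  have hrate {h : ℝ → ℝ} (hm : Measurable h) {K : ℝ} (hK : 0 < K) (hh : ∀ᵐ w ∂Q, |h w.2| ≤ K) :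
      HasFrequentRate P 𝔅 α Z fun n ω A => empCondE (fun j => Z j ω) n h A
        - condE P (fun ω' => (X ω', Y ω')) Y h A := by
    intro ε hε
    obtain ⟨C, hC, hCn⟩ :=
      hasFrequentRate_empCondE (α := α) h𝔅 hB hZ hZQ hZind hm hK hh ε hε
    refine ⟨C, hC, fun n hn => le_trans (measure_mono ?_) (hCn n hn)⟩
    rintro ω ⟨A, hA, hlt⟩
    refine ⟨A, hA, ?_⟩
    simpa only [hcE hm hA.1] using hlt
  refine ⟨tendsto_outerProb_exists_measure_eq_zero h𝔅 hB hZ hZQ hZind hα,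
    fun i => (hrate (h := fun y => y ^ i) (by fun_prop) (pow_pos hM0 i) (hpow i)).isBigOOuter_iSup,
    (hasFrequentRate_empCondV hZ hZQ hM0 hMQ (fun A hA => ?_) (hrate measurable_id' hM0 hMQ)
      (hrate (h := fun y => y ^ 2) (by fun_prop) (pow_pos hM0 2) (hpow 2))).isBigOOuter_iSup⟩
  -- What remains is the bound `M` on the true conditional mean; it also holds when `Q(A) = 0`, the
  -- quotient then being 0.
  rw [hcE measurable_id' hA, abs_div, abs_of_nonneg measureReal_nonneg]
  exact div_le_of_le_mul₀ measureReal_nonneg hM0.le (abs_integral_indicator_le (h𝔅 A hA) hMQ)
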